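/- For $S\subseteq\mathbb N$ let $\underline\rho(S)=\liminf_{n\to\infty}|S\cap\{0,\dots,n-1\}|/n$ be its lower density. Let $r\in[0,1]$. A set $B\subseteq\mathbb N$ is *partially computable at density $r$* if there is a partial computable function $\varphi$ with $\varphi(n)=B(n)$ for all $n\in\operatorname{dom}\varphi$ and $\underline\rho(\operatorname{dom}\varphi)\ge r$ (where $B(n)$ is the value at $n$ of the characteristic function of $B$). It is *coarsely computable at density $r$* if there is a computable set $C$ with $\underline\rho(\{n: B(n)=C(n)\})\ge r$. A set $A\subseteq\mathbb N$, viewed as a point of Cantor space $2^{\omega}$, is *weakly $n$-random* if it belongs to no (lightface) $\Pi^0_n$ class of $2^\omega$ of measure $0$ for the uniform (fair-coin) measure. Write $\le_{\mathrm T}$ for Turing reducibility and $\le_{\mathrm{tt}}$ for truth-table reducibility: $B\le_{\mathrm{tt}}A$ if there is a computable function that assigns to each $n$ a truth table (a finite list of queries to the oracle together with the finite list of accepted answer patterns) that is satisfied by $A$ if and only if $n\in B$. **Theorem 5.3.** Let $A,B\subseteq\mathbb N$ and $r\in[0,1]$. (i) If $A$ is weakly $1$-random, $B\le_{\mathrm{tt}}A$,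 and $B$ is partially computable at density $r$, then $B$ is coarsely computable at density $r$. (ii) If $A$ is weakly $2$-random, $B\le_{\mathrm T}A$, and $B$ is partially computable at density $r$, then $B$ is coarsely computable at density $r$. -/

import Mathlib

open MeasureTheory Filter

namespace CoarseComputability

noncomputable section

/-! ### Sets of natural numbers and their characteristic functions -/

open Classical in
/-- The characteristic sequence of `A ⊆ ω`, as a point of Cantor space `2^ω = (ℕ → Bool)`. -/
def charSeq (A : Set ℕ) : ℕ → Bool := fun n => decide (n ∈ A)

/-- The characteristic function of `A ⊆ ω` as a (total) function with values in `{0, 1}`. -/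
def charFun (A : Set ℕ) : ℕ →. ℕ := fun n => Part.some (charSeq A n).toNat

/-! ### Densities, partial and coarse computability at density `r` -/

/-- `ρ_n(A) = |A ∩ {0, …, n - 1}| / n` (only its values at `n ≥ 1` matter). -/
def rhoBelow (A : Set ℕ) (n : ℕ) : ℝ := ((A ∩ Set.Iio n).ncard : ℝ) / (n : ℝ)

/-- The lower density `liminf_n ρ_n(A)`. -/
def lowerDensity (A : Set ℕ) : ℝ := liminf (rhoBelow A) atTop

/-- `B` is partially computable at density `r`: some partial computable function agrees with `B`
on its domain, and its domain has lower density at least `r`. -/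
def PartiallyComputableAtDensity (B : Set ℕ) (r : ℝ) : Prop :=
  ∃ φ : ℕ →. Bool, Partrec φ ∧ (∀ n, ∀ b ∈ φ n, b = charSeq B n) ∧ r ≤ lowerDensity φ.Dom

/-- `B` is coarsely computable at density `r`: for some computable set `C`, the set
`{n : B(n) = C(n)}` has lower density at least `r`. -/
def CoarselyComputableAtDensity (B : Set ℕ) (r : ℝ) : Prop :=
  ∃ C : Set ℕ, ComputablePred (fun n => n ∈ C) ∧ r ≤ lowerDensity {n | n ∈ B ↔ n ∈ C}

/-! ### Reducibilities -/

/-- Turing reducibility `B ≤_T A` of sets of natural numbers. -/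
def SetTuringReducible (B A : Set ℕ) : Prop := TuringReducible (charFun B) (charFun A)

/-- A truth table: a finite list of queries and the list of those answer patterns that make
the table true. -/
abbrev TruthTable : Type := List ℕ × List (List Bool)

/-- `A` satisfies the truth table `t`: the answers of `A` to the queries are an accepted pattern. -/
def TruthTable.Sat (t : TruthTable) (A : Set ℕ) : Prop := t.1.map (charSeq A) ∈ t.2

/-- Truth-table reducibility `B ≤_tt A`: one can compute from `n` a truth table that `A` satisfies
if and only if `n ∈ B`. -/
def SetTTReducible (B A : Set ℕ) : Prop :=
  ∃ f : ℕ → TruthTable, Computable f ∧ ∀ n, n ∈ B ↔ TruthTable.Sat (f n) A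

/-! ### Effective Borel classes and weak randomness -/

/-- The basic clopen set `[σ]` of all `X ∈ 2^ω` that extend the finite binary string `σ`. -/
def cyl (σ : List Bool) : Set (ℕ → Bool) := {X | (List.range σ.length).map X = σ}

/-- Uniformly `Σ⁰_n` sequences of classes in `2^ω`. For `n = 0` these are the sequences of clopen
classes `⋃_{σ ∈ F k} [σ]` with `F` a computable sequence of finite sets of strings;
`Σ⁰_{n+1}` classes are effective unions of `Π⁰_n` classes, uniformly. -/
def UniformlySigma : ℕ → (ℕ → Set (ℕ → Bool)) → Prop
  | 0, U => ∃ F : ℕ → List (List Bool), Computable F ∧ ∀ k, U k = ⋃ σ ∈ F k, cyl σ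
  | n + 1, U => ∃ V : ℕ → Set (ℕ → Bool), UniformlySigma n V ∧
      ∀ k, U k = ⋃ j, (V (Nat.pair k j))ᶜ

/-- `P` is a `Σ⁰_n` class: a member of a uniformly `Σ⁰_n` sequence. -/
def IsSigmaClass (n : ℕ) (P : Set (ℕ → Bool)) : Prop :=
  ∃ U : ℕ → Set (ℕ → Bool), UniformlySigma n U ∧ U 0 = P

/-- `P` is a `Π⁰_n` class: its complement is a `Σ⁰_n` class. -/
def IsPiClass (n : ℕ) (P : Set (ℕ → Bool)) : Prop := IsSigmaClass n Pᶜ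

/-- Lebesgue (fair coin) measure on `2^ω`. -/
def cantorMeasure : Measure (ℕ → Bool) :=
  Measure.infinitePi (fun _ : ℕ => (PMF.uniformOfFintype Bool).toMeasure)

/-- `A` is weakly `n`-random: it belongs to no `Π⁰_n` class of measure `0`. -/
def WeaklyRandom (n : ℕ) (A : Set ℕ) : Prop :=
  ∀ P : Set (ℕ → Bool), IsPiClass n P → cantorMeasure P = 0 → charSeq A ∉ P

end

end CoarseComputability

namespace CoarseComputability

/-! Fix a functional `Ψ` reducing `B` to `A`, and let `P` be the class of oracles `X` for which `Ψ`
is total and agrees with `φ` wherever `φ` is defined. Then `A` belongs to `P`. Totality and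
agreement together form a `∀ ∃` condition, so `P` is a `Π⁰_2` class. A truth-table functional is
total on every oracle, so only the `∀` condition of never contradicting `φ` is left, and `P` is a
`Π⁰_1` class. In either case weak randomness of `A` forces `P` to have positive measure.

By Lebesgue density (`exists_cyl_density`) `P` fills more than `3 / 4` of some cylinder `[σ]`. To
compute `C(n)`, search for a length at which `Ψ` has converged at `n` on more than `3 / 4` of the
extensions of `σ`, and output the majority answer (`majorityVote`). The search halts because `Ψ` is
total on `P` (`majorityVote_dom`). If `φ(n)` is defined, every oracle in `P` that has answered is
right, so wrong answers occupy less than `1 / 4` and the vote equals `B(n)`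
(`true_mem_majorityVote_iff`). Hence `C` agrees with `B` on the domain of `φ`, and the density bound
carries over.

Functionals are primitive recursive in a finite oracle string, so that the matrices of these classes
and the vote counts are decidable (`exists_functional_of_recursiveIn`). -/

/-- The initial segment of length `k` of `X`. -/
def initSeg (X : ℕ → Bool) (k : ℕ) : List Bool := (List.range k).map X

@[simp]
theorem length_initSeg (X : ℕ → Bool) (k : ℕ) : (initSeg X k).length = k := by simp [initSeg]

theorem initSeg_add (X : ℕ → Bool) (k l : ℕ) :
    initSeg X (k + l) = initSeg X k ++ initSeg (fun i => X (k + i)) l := by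
  simp [initSeg, List.range_add, Function.comp_def]

theorem initSeg_prefix (X : ℕ → Bool) {k l : ℕ} (h : k ≤ l) : initSeg X k <+: initSeg X l := by
  obtain ⟨d, rfl⟩ := Nat.exists_eq_add_of_le h
  rw [initSeg_add]
  exact List.prefix_append _ _

/-! ### Oracle computation by monotone functionals on strings -/

/-- A primitive recursive functional: it reads a finite string of oracle answers, whose length
also bounds the number of steps, and its outputs persist when the string is extended. -/
structure IsFunctional (Ψ : List Bool → ℕ → Option ℕ) : Prop where
  primrec : Primrec₂ Ψ
  mono : ∀ {σ τ : List Bool} {n v : ℕ}, σ <+: τ → v ∈ Ψ σ n → v ∈ Ψ τ n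

/-- `Ψ` computes `f` from the oracle `X`. -/
def Computes (Ψ : List Bool → ℕ → Option ℕ) (X : ℕ → Bool) (f : ℕ →. ℕ) : Prop :=
  ∀ n v, v ∈ f n ↔ ∃ k, v ∈ Ψ (initSeg X k) n

theorem IsFunctional.mono_initSeg {Ψ : List Bool → ℕ → Option ℕ} (hΨ : IsFunctional Ψ)
    {X : ℕ → Bool} {k l n v : ℕ} (h : k ≤ l) (hv : v ∈ Ψ (initSeg X k) n) :
    v ∈ Ψ (initSeg X l) n :=
  hΨ.mono (initSeg_prefix X h) hv

theorem IsFunctional.unique {Ψ : List Bool → ℕ → Option ℕ} (hΨ : IsFunctional Ψ)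
    {X : ℕ → Bool} {k l n v w : ℕ} (hv : v ∈ Ψ (initSeg X k) n) (hw : w ∈ Ψ (initSeg X l) n) :
    v = w :=
  Option.mem_unique (hΨ.mono_initSeg (le_max_left k l) hv) (hΨ.mono_initSeg (le_max_right k l) hw)

theorem isFunctional_of_primrec {g : ℕ → ℕ} (hg : Primrec g) :
    IsFunctional fun _ n => some (g n) where
  primrec := Primrec.option_some.comp (hg.comp Primrec.snd)
  mono _ h := h

theorem computes_of_eq {g : ℕ → ℕ} (X : ℕ → Bool) {f : ℕ →. ℕ} (h : ∀ n, f n = Part.some (g n)) :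
    Computes (fun _ n => some (g n)) X f := by
  intro n v
  simp [h, eq_comm]

/-- The functional that returns the `n`-th oracle answer. -/
def oracleFunctional (σ : List Bool) (n : ℕ) : Option ℕ := (σ[n]?).map fun b => cond b 1 0

theorem isFunctional_oracle : IsFunctional oracleFunctional where
  primrec := Primrec.option_map Primrec.list_getElem?
    ((Primrec.cond Primrec.snd (Primrec.const 1) (Primrec.const 0)).to₂)
  mono := by
    rintro σ _ n v ⟨ρ, rfl⟩ h
    simp only [oracleFunctional, Option.mem_def, Option.map_eq_some_iff] at h ⊢
    obtain ⟨b, hb, rfl⟩ := h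
    exact ⟨b, by rw [List.getElem?_append_left (List.getElem?_eq_some_iff.1 hb).1, hb], rfl⟩

theorem computes_oracle (A : Set ℕ) : Computes oracleFunctional (charSeq A) (charFun A) := by
  intro n v
  simp only [charFun, Part.mem_some_iff, oracleFunctional, Option.mem_def,
    Option.map_eq_some_iff]
  constructor
  · rintro rfl
    exact ⟨n + 1, charSeq A n, by simp [initSeg], by cases charSeq A n <;> rfl⟩
  · rintro ⟨k, b, hb, rfl⟩
    have : n < k := by simpa using (List.getElem?_eq_some_iff.1 hb).1
    simp only [initSeg, List.getElem?_map, List.getElem?_range this, Option.map_some,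
      Option.some.injEq] at hb
    rw [hb]
    cases b <;> rfl

/-- Functional computing the pairing of two functions. -/
def pairFunctional (Φ Ψ : List Bool → ℕ → Option ℕ) (σ : List Bool) (n : ℕ) : Option ℕ :=
  (Φ σ n).bind fun a => (Ψ σ n).map fun b => Nat.pair a b

theorem mem_pairFunctional {Φ Ψ : List Bool → ℕ → Option ℕ} {σ : List Bool} {n v : ℕ} :
    v ∈ pairFunctional Φ Ψ σ n ↔ ∃ a ∈ Φ σ n, ∃ b ∈ Ψ σ n, Nat.pair a b = v := by
  simp [pairFunctional, Option.bind_eq_some_iff]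

theorem IsFunctional.pair {Φ Ψ : List Bool → ℕ → Option ℕ} (hΦ : IsFunctional Φ)
    (hΨ : IsFunctional Ψ) : IsFunctional (pairFunctional Φ Ψ) where
  primrec := by
    refine Primrec.option_bind hΦ.primrec ?_
    refine Primrec.option_map (hΨ.primrec.comp (Primrec.fst.comp Primrec.fst)
      (Primrec.snd.comp Primrec.fst)) ?_
    exact Primrec₂.natPair.comp (Primrec.snd.comp Primrec.fst) Primrec.snd
  mono := by
    intro σ τ n v h hv
    rw [mem_pairFunctional] at hv ⊢
    obtain ⟨a, ha, b, hb, rfl⟩ := hv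
    exact ⟨a, hΦ.mono h ha, b, hΨ.mono h hb, rfl⟩

theorem Computes.pair {Φ Ψ : List Bool → ℕ → Option ℕ} (hΦ : IsFunctional Φ)
    (hΨ : IsFunctional Ψ) {X : ℕ → Bool} {f g : ℕ →. ℕ} (hf : Computes Φ X f)
    (hg : Computes Ψ X g) :
    Computes (pairFunctional Φ Ψ) X fun n => Nat.pair <$> f n <*> g n := by
  intro n v
  simp only [mem_pairFunctional]
  have : v ∈ (Nat.pair <$> f n <*> g n) ↔ ∃ a ∈ f n, ∃ b ∈ g n, Nat.pair a b = v := by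
    simp [Seq.seq, eq_comm]
  rw [this]
  constructor
  · rintro ⟨a, ha, b, hb, rfl⟩
    obtain ⟨k, hk⟩ := (hf n a).1 ha
    obtain ⟨l, hl⟩ := (hg n b).1 hb
    exact ⟨max k l, a, hΦ.mono_initSeg (le_max_left _ _) hk, b,
      hΨ.mono_initSeg (le_max_right _ _) hl, rfl⟩
  · rintro ⟨k, a, ha, b, hb, rfl⟩
    exact ⟨a, (hf n a).2 ⟨k, ha⟩, b, (hg n b).2 ⟨k, hb⟩, rfl⟩

/-- Functional computing the composition of two functions. -/
def compFunctional (Φ Ψ : List Bool → ℕ → Option ℕ) (σ : List Bool) (n : ℕ) : Option ℕ :=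
  (Ψ σ n).bind (Φ σ)

theorem mem_compFunctional {Φ Ψ : List Bool → ℕ → Option ℕ} {σ : List Bool} {n v : ℕ} :
    v ∈ compFunctional Φ Ψ σ n ↔ ∃ a ∈ Ψ σ n, v ∈ Φ σ a := by
  simp [compFunctional, Option.bind_eq_some_iff]

theorem IsFunctional.comp {Φ Ψ : List Bool → ℕ → Option ℕ} (hΦ : IsFunctional Φ)
    (hΨ : IsFunctional Ψ) : IsFunctional (compFunctional Φ Ψ) where
  primrec := Primrec.option_bind hΨ.primrec
    (hΦ.primrec.comp (Primrec.fst.comp Primrec.fst) Primrec.snd)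
  mono := by
    intro σ τ n v h hv
    rw [mem_compFunctional] at hv ⊢
    obtain ⟨a, ha, hv⟩ := hv
    exact ⟨a, hΨ.mono h ha, hΦ.mono h hv⟩

theorem Computes.comp {Φ Ψ : List Bool → ℕ → Option ℕ} (hΦ : IsFunctional Φ)
    (hΨ : IsFunctional Ψ) {X : ℕ → Bool} {f g : ℕ →. ℕ} (hf : Computes Φ X f)
    (hg : Computes Ψ X g) :
    Computes (compFunctional Φ Ψ) X fun n => g n >>= f := by
  intro n v
  have hbind : v ∈ (g n >>= f) ↔ ∃ a ∈ g n, v ∈ f a := Part.mem_bind_iff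
  simp only [mem_compFunctional]
  rw [hbind]
  constructor
  · rintro ⟨a, ha, hv⟩
    obtain ⟨k, hk⟩ := (hg n a).1 ha
    obtain ⟨l, hl⟩ := (hf a v).1 hv
    exact ⟨max k l, a, hΨ.mono_initSeg (le_max_left _ _) hk,
      hΦ.mono_initSeg (le_max_right _ _) hl⟩
  · rintro ⟨k, a, ha, hv⟩
    exact ⟨a, (hg n a).2 ⟨k, ha⟩, (hf a v).2 ⟨k, hv⟩⟩

/-- Functional computing a primitive recursion on `n` with parameter `a`. -/
def recFunctional (Φ Ψ : List Bool → ℕ → Option ℕ) (σ : List Bool) (a n : ℕ) : Option ℕ :=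
  n.rec (Φ σ a) fun y IH => IH.bind fun i => Ψ σ (Nat.pair a (Nat.pair y i))

/-- Functional computing the function obtained by primitive recursion, with paired arguments. -/
def precFunctional (Φ Ψ : List Bool → ℕ → Option ℕ) (σ : List Bool) (p : ℕ) : Option ℕ :=
  recFunctional Φ Ψ σ p.unpair.1 p.unpair.2

theorem mem_recFunctional_succ {Φ Ψ : List Bool → ℕ → Option ℕ} {σ : List Bool} {a n v : ℕ} :
    v ∈ recFunctional Φ Ψ σ a (n + 1) ↔
      ∃ i ∈ recFunctional Φ Ψ σ a n, v ∈ Ψ σ (Nat.pair a (Nat.pair n i)) := by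
  simp [recFunctional, Option.bind_eq_some_iff]

theorem recFunctional_mono {Φ Ψ : List Bool → ℕ → Option ℕ} (hΦ : IsFunctional Φ)
    (hΨ : IsFunctional Ψ) {σ τ : List Bool} (h : σ <+: τ) (a n : ℕ) :
    ∀ v, v ∈ recFunctional Φ Ψ σ a n → v ∈ recFunctional Φ Ψ τ a n := by
  induction n with
  | zero => exact fun v hv => hΦ.mono h hv
  | succ n ih =>
    intro v hv
    rw [mem_recFunctional_succ] at hv ⊢
    obtain ⟨i, hi, hv⟩ := hv
    exact ⟨i, ih i hi, hΨ.mono h hv⟩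

theorem IsFunctional.prec {Φ Ψ : List Bool → ℕ → Option ℕ} (hΦ : IsFunctional Φ)
    (hΨ : IsFunctional Ψ) : IsFunctional (precFunctional Φ Ψ) where
  primrec := by
    have h1 : Primrec fun p : List Bool × ℕ => p.2.unpair.1 :=
      Primrec.fst.comp (Primrec.unpair.comp Primrec.snd)
    have h2 : Primrec fun p : List Bool × ℕ => p.2.unpair.2 :=
      Primrec.snd.comp (Primrec.unpair.comp Primrec.snd)
    change Primrec fun p : List Bool × ℕ => precFunctional Φ Ψ p.1 p.2
    unfold precFunctional recFunctional
    refine Primrec.nat_rec' (h := fun p q => q.2.bind fun i =>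
      Ψ p.1 (Nat.pair p.2.unpair.1 (Nat.pair q.1 i))) h2 (hΦ.primrec.comp Primrec.fst h1) ?_
    refine Primrec.option_bind (Primrec.snd.comp Primrec.snd) ?_
    refine hΨ.primrec.comp (Primrec.fst.comp (Primrec.fst.comp Primrec.fst)) ?_
    exact Primrec₂.natPair.comp (h1.comp (Primrec.fst.comp Primrec.fst))
      (Primrec₂.natPair.comp (Primrec.fst.comp (Primrec.snd.comp Primrec.fst)) Primrec.snd)
  mono h hv := recFunctional_mono hΦ hΨ h _ _ _ hv

theorem Computes.prec {Φ Ψ : List Bool → ℕ → Option ℕ} (hΦ : IsFunctional Φ)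
    (hΨ : IsFunctional Ψ) {X : ℕ → Bool} {f g : ℕ →. ℕ} (hf : Computes Φ X f)
    (hg : Computes Ψ X g) :
    Computes (precFunctional Φ Ψ) X fun p =>
      let (a, n) := Nat.unpair p
      n.rec (f a) fun y IH => IH >>= fun i => g (Nat.pair a (Nat.pair y i)) := by
  have key : ∀ a n v, v ∈ (n.rec (f a) fun y IH =>
      Part.bind IH fun i => g (Nat.pair a (Nat.pair y i)) : Part ℕ) ↔
      ∃ k, v ∈ recFunctional Φ Ψ (initSeg X k) a n := by
    intro a n
    induction n with
    | zero => exact hf a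
    | succ n ih =>
      intro v
      simp only [mem_recFunctional_succ, Part.mem_bind_iff, ih]
      constructor
      · rintro ⟨i, ⟨k, hk⟩, hv⟩
        obtain ⟨l, hl⟩ := (hg _ v).1 hv
        exact ⟨max k l, i, recFunctional_mono hΦ hΨ (initSeg_prefix X (le_max_left _ _)) _ _ _ hk,
          hΨ.mono_initSeg (le_max_right _ _) hl⟩
      · rintro ⟨k, i, hi, hv⟩
        exact ⟨i, ⟨k, hi⟩, (hg _ v).2 ⟨k, hv⟩⟩
  exact fun p v => key p.unpair.1 p.unpair.2 v

/-- Functional for unbounded search: find the first argument at which `Φ` either vanishes or has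
not yet converged, and return it in the former case. -/
def rfindFunctional (Φ : List Bool → ℕ → Option ℕ) (σ : List Bool) (a : ℕ) : Option ℕ :=
  let i := (List.range σ.length).findIdx fun k => (Φ σ (Nat.pair a k)).getD 0 == 0
  (Φ σ (Nat.pair a i)).bind fun v => if v = 0 then some i else none

/-- Stopping at an unconverged value is what makes the right-hand side persist when `σ` grows. The
bound `v ≤ σ.length` is not strict because `findIdx` returns the length when nothing is found, and
that index is then tested too. -/
theorem mem_rfindFunctional {Φ : List Bool → ℕ → Option ℕ} {σ : List Bool} {a v : ℕ} :
    v ∈ rfindFunctional Φ σ a ↔ v ≤ σ.length ∧ 0 ∈ Φ σ (Nat.pair a v) ∧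
      ∀ k < v, ∃ m ≠ 0, m ∈ Φ σ (Nat.pair a k) := by
  set p : ℕ → Bool := fun k => (Φ σ (Nat.pair a k)).getD 0 == 0 with hp
  have hpf : ∀ k, p k = false ↔ ∃ m ≠ 0, m ∈ Φ σ (Nat.pair a k) := by
    intro k
    simp only [hp]
    cases Φ σ (Nat.pair a k) with
    | none => simp
    | some w => simp only [Option.getD_some, beq_eq_false_iff_ne, Option.mem_def,
        Option.some.injEq, exists_eq_right']
  set i := (List.range σ.length).findIdx p with hi
  have hil : i ≤ σ.length := by simpa using List.findIdx_le_length (xs := List.range σ.length) (p := p)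
  have hlt : ∀ k < i, p k = false := by
    intro k hk
    have := List.not_of_lt_findIdx hk
    simpa using this
  have hmem : v ∈ rfindFunctional Φ σ a ↔ 0 ∈ Φ σ (Nat.pair a i) ∧ v = i := by
    change v ∈ ((Φ σ (Nat.pair a i)).bind fun w => if w = 0 then some i else none) ↔ _
    simp only [Option.mem_def, Option.bind_eq_some_iff]
    constructor
    · rintro ⟨w, hw, h⟩
      split_ifs at h with h0
      subst h0
      exact ⟨hw, (Option.some.inj h).symm⟩
    · rintro ⟨h, rfl⟩
      exact ⟨0, h, by simp⟩
  rw [hmem]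
  constructor
  · rintro ⟨h0, rfl⟩
    exact ⟨hil, h0, fun k hk => (hpf k).1 (hlt k hk)⟩
  · rintro ⟨hv, h0, hk⟩
    have hpv : p v = true := by
      simp only [hp]
      rw [Option.mem_def.1 h0]
      rfl
    have h1 : i ≤ v := by
      by_contra! h
      have := hlt v h
      simp [hpv] at this
    have h2 : v ≤ i := by
      by_contra! h
      have hil' : i < (List.range σ.length).length := by
        simpa using lt_of_lt_of_le h hv
      have := List.findIdx_getElem (w := hil')
      simp only [List.getElem_range, ← hi] at this
      rw [(hpf i).2 (hk i h)] at this
      cases this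
    have : v = i := le_antisymm h2 h1
    exact ⟨this ▸ h0, this⟩

theorem IsFunctional.rfind {Φ : List Bool → ℕ → Option ℕ} (hΦ : IsFunctional Φ) :
    IsFunctional (rfindFunctional Φ) where
  primrec := by
    have hval : Primrec₂ fun (p : List Bool × ℕ) (k : ℕ) => Φ p.1 (Nat.pair p.2 k) :=
      hΦ.primrec.comp (Primrec.fst.comp Primrec.fst)
        (Primrec₂.natPair.comp (Primrec.snd.comp Primrec.fst) Primrec.snd)
    have hidx : Primrec fun p : List Bool × ℕ =>
        (List.range p.1.length).findIdx fun k => (Φ p.1 (Nat.pair p.2 k)).getD 0 == 0 := by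
      refine Primrec.list_findIdx (Primrec.list_range.comp (Primrec.list_length.comp Primrec.fst)) ?_
      exact Primrec.beq.comp (Primrec.option_getD.comp hval (Primrec.const 0)) (Primrec.const 0)
    refine Primrec.option_bind (hval.comp Primrec.id hidx) ?_
    exact Primrec.ite (Primrec.eq.comp Primrec.snd (Primrec.const 0))
      (Primrec.option_some.comp (hidx.comp Primrec.fst)) (Primrec.const none)
  mono := by
    intro σ τ n v h hv
    rw [mem_rfindFunctional] at hv ⊢
    obtain ⟨h1, h2, h3⟩ := hv
    refine ⟨h1.trans h.length_le, hΦ.mono h h2, fun k hk => ?_⟩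
    obtain ⟨m, hm, hv⟩ := h3 k hk
    exact ⟨m, hm, hΦ.mono h hv⟩

theorem Computes.rfind {Φ : List Bool → ℕ → Option ℕ} (hΦ : IsFunctional Φ) {X : ℕ → Bool}
    {f : ℕ →. ℕ} (hf : Computes Φ X f) :
    Computes (rfindFunctional Φ) X fun a =>
      Nat.rfind fun n => (fun m => m = 0) <$> f (Nat.pair a n) := by
  intro a v
  have hrf : v ∈ (Nat.rfind fun n => (fun m => decide (m = 0)) <$> f (Nat.pair a n)) ↔
      (∃ m ∈ f (Nat.pair a v), decide (m = 0) = true) ∧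
      ∀ {k}, k < v → ∃ m ∈ f (Nat.pair a k), decide (m = 0) = false := by
    refine Nat.mem_rfind.trans (and_congr (Part.mem_map_iff _) ?_)
    exact forall_congr' fun k => imp_congr_right fun _ => Part.mem_map_iff _
  simp only [mem_rfindFunctional, length_initSeg]
  rw [hrf]
  constructor
  · rintro ⟨⟨m, hm, hm0⟩, hlt⟩
    obtain rfl : m = 0 := by simpa using hm0
    have h0 := (hf _ _).1 hm
    obtain ⟨k, hk⟩ := h0
    have : ∀ j, ∃ l, j < v → ∃ m ≠ 0, m ∈ Φ (initSeg X l) (Nat.pair a j) := by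
      intro j
      by_cases hj : j < v
      · obtain ⟨m, hm, hm0⟩ := hlt hj
        obtain ⟨l, hl⟩ := (hf _ _).1 hm
        exact ⟨l, fun _ => ⟨m, by simpa using hm0, hl⟩⟩
      · exact ⟨0, fun h => absurd h hj⟩
    choose l hl using this
    -- One length beyond all the convergence lengths; the summand `v` pays for the search bound.
    refine ⟨v + k + ∑ j ∈ Finset.range v, l j, by omega, hΦ.mono_initSeg (by omega) hk, ?_⟩
    intro j hj
    obtain ⟨m, hm, hv⟩ := hl j hj
    refine ⟨m, hm, hΦ.mono_initSeg ?_ hv⟩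
    have := Finset.single_le_sum (f := l) (fun _ _ => Nat.zero_le _) (Finset.mem_range.2 hj)
    omega
  · rintro ⟨k, -, h0, hlt⟩
    refine ⟨⟨0, (hf _ _).2 ⟨k, h0⟩, by simp⟩, fun {j} hj => ?_⟩
    obtain ⟨m, hm, hv⟩ := hlt j hj
    exact ⟨m, (hf _ _).2 ⟨k, hv⟩, by simpa using hm⟩

/-- Every function recursive in `A` is computed from `A` by a primitive recursive functional. -/
theorem exists_functional_of_recursiveIn {A : Set ℕ} {f : ℕ →. ℕ}
    (h : Nat.RecursiveIn {charFun A} f) :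
    ∃ Ψ, IsFunctional Ψ ∧ Computes Ψ (charSeq A) f := by
  induction h with
  | zero => exact ⟨_, isFunctional_of_primrec (Primrec.const 0), computes_of_eq _ fun _ => rfl⟩
  | succ => exact ⟨_, isFunctional_of_primrec Primrec.succ, computes_of_eq _ fun _ => rfl⟩
  | left =>
    exact ⟨_, isFunctional_of_primrec (Primrec.fst.comp Primrec.unpair),
      computes_of_eq _ fun _ => rfl⟩
  | right =>
    exact ⟨_, isFunctional_of_primrec (Primrec.snd.comp Primrec.unpair),
      computes_of_eq _ fun _ => rfl⟩
  | oracle g hg =>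
    rw [Set.mem_singleton_iff.1 hg]
    exact ⟨_, isFunctional_oracle, computes_oracle A⟩
  | pair _ _ ihf ihg =>
    obtain ⟨Φ, hΦ, hf⟩ := ihf
    obtain ⟨Ψ, hΨ, hg⟩ := ihg
    exact ⟨_, hΦ.pair hΨ, hf.pair hΦ hΨ hg⟩
  | comp _ _ ihf ihg =>
    obtain ⟨Φ, hΦ, hf⟩ := ihf
    obtain ⟨Ψ, hΨ, hg⟩ := ihg
    exact ⟨_, hΦ.comp hΨ, hf.comp hΦ hΨ hg⟩
  | prec _ _ ihf ihg =>
    obtain ⟨Φ, hΦ, hf⟩ := ihf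
    obtain ⟨Ψ, hΨ, hg⟩ := ihg
    exact ⟨_, hΦ.prec hΨ, hf.prec hΦ hΨ hg⟩
  | rfind _ ihf =>
    obtain ⟨Φ, hΦ, hf⟩ := ihf
    exact ⟨_, hΦ.rfind, hf.rfind hΦ⟩

/-! ### Binary strings, cylinders and their measure -/

/-- The list of all binary strings of length `n`. -/
def strings : ℕ → List (List Bool)
  | 0 => [[]]
  | n + 1 => (strings n).flatMap fun l => [false :: l, true :: l]

theorem mem_strings {n : ℕ} {l : List Bool} : l ∈ strings n ↔ l.length = n := by
  induction n generalizing l with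
  | zero => simp [strings]
  | succ n ih =>
    cases l with
    | nil => simp [strings]
    | cons b l => cases b <;> simp [strings, ih]

theorem nodup_strings (n : ℕ) : (strings n).Nodup := by
  induction n with
  | zero => simp [strings]
  | succ n ih =>
    rw [strings, List.nodup_flatMap]
    refine ⟨fun l _ => by simp, ih.imp fun h => ?_⟩
    simp [Function.onFun, h.symm]

theorem primrec_strings : Primrec strings := by
  have h : Primrec fun n : ℕ => (n.rec [[]] fun _ ih =>
      ih.flatMap fun l => [false :: l, true :: l] : List (List Bool)) := by
    refine Primrec.nat_rec' (h := fun _ (q : ℕ × List (List Bool)) =>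
      q.2.flatMap fun l => [false :: l, true :: l])
      Primrec.id (Primrec.const _) ?_
    refine Primrec.list_flatMap (Primrec.snd.comp Primrec.snd) ?_
    exact Primrec.list_cons.comp (Primrec.list_cons.comp (Primrec.const _) Primrec.snd)
      (Primrec.list_cons.comp (Primrec.list_cons.comp (Primrec.const _) Primrec.snd)
        (Primrec.const _))
  refine h.of_eq fun n => ?_
  induction n with
  | zero => rfl
  | succ n ih => simp only [strings, ih]

theorem length_strings (n : ℕ) : (strings n).length = 2 ^ n := by
  induction n with
  | zero => rfl
  | succ n ih => simp [strings, List.length_flatMap, ih, pow_succ]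

theorem mem_cyl {σ : List Bool} {X : ℕ → Bool} : X ∈ cyl σ ↔ initSeg X σ.length = σ := Iff.rfl

theorem mem_cyl_initSeg {X Y : ℕ → Bool} {k : ℕ} :
    Y ∈ cyl (initSeg X k) ↔ initSeg Y k = initSeg X k := by
  rw [mem_cyl, length_initSeg]

theorem cyl_eq_pi (σ : List Bool) :
    cyl σ = Set.pi (Finset.range σ.length) fun i => {σ.getD i false} := by
  ext X
  rw [mem_cyl, List.ext_getElem_iff]
  simp only [initSeg, List.length_map, List.length_range, true_and, List.getElem_map,
    List.getElem_range, Set.mem_pi, Finset.coe_range, Set.mem_Iio, Set.mem_singleton_iff]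
  refine forall_congr' fun i => ⟨fun h hi => ?_, fun h hi _ => ?_⟩
  · rw [h hi hi, List.getD_eq_getElem _ _ hi]
  · rw [h hi, List.getD_eq_getElem _ _ hi]

theorem measurableSet_cyl (σ : List Bool) : MeasurableSet (cyl σ) := by
  rw [cyl_eq_pi]
  exact MeasurableSet.pi (Finset.countable_toSet _) fun _ _ => measurableSet_singleton _

instance : IsProbabilityMeasure cantorMeasure := by
  unfold cantorMeasure
  infer_instance

theorem cantorMeasure_cyl (σ : List Bool) : cantorMeasure (cyl σ) = (2⁻¹ : ENNReal) ^ σ.length := by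
  rw [cyl_eq_pi, cantorMeasure, Measure.infinitePi_pi _ fun _ _ => measurableSet_singleton _]
  simp

theorem cantorMeasure_real_cyl (σ : List Bool) : cantorMeasure.real (cyl σ) = 2⁻¹ ^ σ.length := by
  simp [Measure.real, cantorMeasure_cyl]

theorem setOf_initSeg_mem_eq (k : ℕ) (S : Finset (List Bool)) (hS : ∀ τ ∈ S, τ.length = k) :
    {X | initSeg X k ∈ S} = ⋃ τ ∈ S, cyl τ := by
  ext X
  simp only [Set.mem_ofPred_eq, Set.mem_iUnion, mem_cyl, exists_prop]
  refine ⟨fun h => ⟨_, h, by simp⟩, ?_⟩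
  rintro ⟨τ, hτ, h⟩
  rw [hS τ hτ] at h
  rwa [h]

theorem cantorMeasure_setOf_initSeg_mem (k : ℕ) (S : Finset (List Bool))
    (hS : ∀ τ ∈ S, τ.length = k) :
    cantorMeasure {X | initSeg X k ∈ S} = ∑ τ ∈ S, cantorMeasure (cyl τ) := by
  rw [setOf_initSeg_mem_eq k S hS, measure_biUnion_finset _ fun τ _ => measurableSet_cyl τ]
  intro τ hτ ρ hρ hne
  rw [Function.onFun, Set.disjoint_left]
  intro X h1 h2
  rw [mem_cyl, hS _ hτ] at h1
  rw [mem_cyl, hS _ hρ] at h2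
  exact hne (h1.symm.trans h2)

theorem measurableSet_setOf_initSeg (k : ℕ) (p : List Bool → Prop) :
    MeasurableSet {X | p (initSeg X k)} := by
  classical
  have : {X | p (initSeg X k)} = {X | initSeg X k ∈ (strings k).toFinset.filter p} := by
    ext X
    simp [mem_strings]
  rw [this, setOf_initSeg_mem_eq _ _ (by simp +contextual [mem_strings])]
  exact Finset.measurableSet_biUnion _ fun τ _ => measurableSet_cyl τ

/-- The measure of a clopen subset of a cylinder, by counting strings. -/
theorem cantorMeasure_real_cyl_inter (σ : List Bool) (m : ℕ) (p : List Bool → Bool) :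
    cantorMeasure.real (cyl σ ∩ {X | p (initSeg X (σ.length + m))}) =
      ((strings m).countP fun ρ => p (σ ++ ρ)) * 2⁻¹ ^ (σ.length + m) := by
  set L := ((strings m).filter fun ρ => p (σ ++ ρ)).map (σ ++ ·) with hL
  have hnd : L.Nodup := ((nodup_strings m).filter _).map (List.append_right_injective σ)
  have hlen : ∀ τ ∈ L.toFinset, τ.length = σ.length + m := by
    intro τ hτ
    simp only [hL, List.mem_toFinset, List.mem_map, List.mem_filter, mem_strings] at hτ
    obtain ⟨ρ, ⟨h, -⟩, rfl⟩ := hτ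
    simp [h]
  have heq : cyl σ ∩ {X | p (initSeg X (σ.length + m))} =
      {X | initSeg X (σ.length + m) ∈ L.toFinset} := by
    ext X
    simp only [hL, Set.mem_inter_iff, mem_cyl, Set.mem_ofPred_eq, List.mem_toFinset, List.mem_map,
      List.mem_filter, mem_strings, initSeg_add]
    constructor
    · rintro ⟨h1, h2⟩
      rw [h1] at h2 ⊢
      exact ⟨_, ⟨by simp, h2⟩, rfl⟩
    · rintro ⟨ρ, ⟨h1, h2⟩, h3⟩
      obtain ⟨h4, h5⟩ := List.append_inj h3 (by simp)
      rw [← h3]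
      exact ⟨h4.symm, h2⟩
  rw [heq, Measure.real, cantorMeasure_setOf_initSeg_mem _ _ hlen,
    Finset.sum_congr rfl fun τ hτ => by rw [cantorMeasure_cyl, hlen τ hτ], Finset.sum_const,
    List.toFinset_card_of_nodup hnd, hL, List.length_map, ← List.countP_eq_length_filter]
  simp

/-! ### Lebesgue density on Cantor space -/

theorem exists_cyl_subset_of_isOpen {U : Set (ℕ → Bool)} (hU : IsOpen U) {X : ℕ → Bool}
    (hX : X ∈ U) : ∃ k, cyl (initSeg X k) ⊆ U := by
  obtain ⟨I, u, hu, hsub⟩ := isOpen_pi_iff.1 hU X hX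
  refine ⟨I.sup id + 1, fun Y hY => hsub fun i hi => ?_⟩
  rw [mem_cyl_initSeg] at hY
  have hlt : i < I.sup id + 1 := Nat.lt_succ_of_le (Finset.le_sup (f := id) hi)
  have : Y i = X i := by
    have := congrArg (fun l => l[i]?) hY
    simpa [initSeg, List.getElem?_range hlt] using this
  rw [this]
  exact (hu i hi).2

/-- A set of positive measure has relative measure above `3 / 4` in some cylinder. -/
theorem exists_cyl_density {P : Set (ℕ → Bool)} (hP : cantorMeasure P ≠ 0) :
    ∃ σ, 3 * cantorMeasure (cyl σ) < 4 * cantorMeasure (P ∩ cyl σ) := by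
  classical
  by_contra! hcon
  -- If `P` fills at most `3 / 4` of every cylinder, the same bound holds relative to any open `U ⊇
  -- P`: sum over the disjoint cylinders of length `k` inside `U`, then let `k` grow until they
  -- exhaust `P`.
  have hopen : ∀ U, IsOpen U → P ⊆ U → 4 * cantorMeasure P ≤ 3 * cantorMeasure U := by
    intro U hU hPU
    have hk : ∀ k, 4 * cantorMeasure (P ∩ {X | cyl (initSeg X k) ⊆ U}) ≤ 3 * cantorMeasure U := by
      intro k
      set S := (strings k).toFinset.filter fun τ => cyl τ ⊆ U with hS
      have hlen : ∀ τ ∈ S, τ.length = k := by simp +contextual [hS, mem_strings]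
      have hset : {X | cyl (initSeg X k) ⊆ U} = {X | initSeg X k ∈ S} := by
        ext X
        simp [hS, mem_strings]
      calc 4 * cantorMeasure (P ∩ {X | cyl (initSeg X k) ⊆ U})
          ≤ 4 * ∑ τ ∈ S, cantorMeasure (P ∩ cyl τ) := by
            rw [hset, setOf_initSeg_mem_eq k S hlen, Set.inter_iUnion₂]
            gcongr
            exact measure_biUnion_finset_le _ _
        _ ≤ 3 * ∑ τ ∈ S, cantorMeasure (cyl τ) := by
            rw [Finset.mul_sum, Finset.mul_sum]
            exact Finset.sum_le_sum fun τ _ => hcon τ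
        _ ≤ 3 * cantorMeasure U := by
            rw [← cantorMeasure_setOf_initSeg_mem k S hlen, ← hset]
            gcongr
            exact fun X hX => hX (mem_cyl_initSeg.2 rfl)
    have hmono : Monotone fun k => P ∩ {X | cyl (initSeg X k) ⊆ U} := by
      intro k l hkl X hX
      refine ⟨hX.1, fun Y hY => hX.2 ?_⟩
      rw [mem_cyl_initSeg] at hY ⊢
      obtain ⟨d, rfl⟩ := Nat.exists_eq_add_of_le hkl
      rw [initSeg_add, initSeg_add] at hY
      exact (List.append_inj hY (by simp)).1
    have hunion : ⋃ k, (P ∩ {X | cyl (initSeg X k) ⊆ U}) = P := by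
      rw [← Set.inter_iUnion, Set.inter_eq_left]
      exact fun X hX => Set.mem_iUnion.2 (exists_cyl_subset_of_isOpen hU (hPU hX))
    rw [← hunion, hmono.measure_iUnion, ENNReal.mul_iSup]
    exact iSup_le hk
  -- Outer regularity replaces `U` by `P` itself, which is absurd for a finite nonzero measure.
  -- Measurability of `P` is not needed.
  have hle : 4 * cantorMeasure P / 3 ≤ cantorMeasure P := by
    refine le_of_forall_gt fun r hr => ?_
    obtain ⟨U, hPU, hU, hUr⟩ := Set.exists_isOpen_lt_of_lt P r hr
    refine lt_of_le_of_lt ?_ hUr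
    refine ENNReal.div_le_of_le_mul ?_
    simpa only [mul_comm] using hopen U hU hPU
  rw [ENNReal.div_le_iff (by simp) (by simp)] at hle
  have hne := measure_ne_top cantorMeasure P
  have h := ENNReal.toReal_mono (by finiteness) hle
  rw [ENNReal.toReal_mul, ENNReal.toReal_mul] at h
  have hpos := ENNReal.toReal_pos hP hne
  norm_num at h
  linarith

/-! ### Lower density and computable sets -/

theorem rhoBelow_mem_Icc (S : Set ℕ) (n : ℕ) : rhoBelow S n ∈ Set.Icc (0 : ℝ) 1 := by
  refine ⟨by unfold rhoBelow; positivity, div_le_one_of_le₀ ?_ (Nat.cast_nonneg n)⟩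
  have h : (S ∩ Set.Iio n).ncard ≤ (Set.Iio n).ncard :=
    Set.ncard_le_ncard Set.inter_subset_right (Set.finite_Iio n)
  rw [← Finset.coe_Iio, Set.ncard_coe_finset, Nat.card_Iio] at h
  exact_mod_cast h

theorem lowerDensity_mono {S T : Set ℕ} (h : S ⊆ T) : lowerDensity S ≤ lowerDensity T := by
  refine liminf_le_liminf (Eventually.of_forall fun n => ?_)
    (isBoundedUnder_of ⟨0, fun n => (rhoBelow_mem_Icc S n).1⟩)
    (IsBoundedUnder.isCoboundedUnder_ge (isBoundedUnder_of ⟨1, fun n => (rhoBelow_mem_Icc T n).2⟩))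
  unfold rhoBelow
  gcongr
  exact (Set.finite_Iio n).inter_of_right T

theorem computablePred_of_total {F : ℕ →. Bool} (hF : Partrec F) (htot : ∀ n, (F n).Dom) :
    ComputablePred fun n => true ∈ F n := by
  rw [ComputablePred.computable_iff]
  refine ⟨fun n => (F n).get (htot n), hF.of_eq fun n => (Part.some_get _).symm, ?_⟩
  ext n
  exact ⟨fun h => Part.get_eq_of_mem h _, fun h => h ▸ Part.get_mem (htot n)⟩

/-! ### The majority vote on a cylinder -/

theorem countP_le_add {α : Type*} {p q s : α → Bool} (h : ∀ a, p a → q a ∨ s a) (l : List α) :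
    l.countP p ≤ l.countP q + l.countP s := by
  induction l with
  | nil => simp
  | cons a l ih =>
    simp only [List.countP_cons]
    have := h a
    split_ifs <;> simp_all <;> omega

theorem primrec_countP_strings {R : List Bool → ℕ → Prop} [DecidableRel R] (hR : PrimrecRel R) :
    Primrec₂ fun (n m : ℕ) => (strings m).countP fun ρ => decide (R ρ n) := by
  refine (Primrec.list_length.comp ((hR.listFilter).comp (primrec_strings.comp Primrec.snd)
    Primrec.fst)).of_eq fun p => ?_
  exact List.countP_eq_length_filter.symm

theorem primrec_length_strings : Primrec fun m => (strings m).length :=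
  Primrec.list_length.comp primrec_strings

/-- Take the majority vote on the value at `n` of `Ψ` over the extensions of `σ`, once `Ψ` has
converged at `n` on more than `3 / 4` of them. -/
def majorityVote (Ψ : List Bool → ℕ → Option ℕ) (σ : List Bool) (n : ℕ) : Part Bool :=
  (Nat.rfind fun m => Part.some (decide
    (3 * (strings m).length < 4 * (strings m).countP fun ρ => decide (Ψ (σ ++ ρ) n ≠ none)))).map
  fun m => decide
    ((strings m).length < 2 * (strings m).countP fun ρ => decide (Ψ (σ ++ ρ) n = some 1))

theorem partrec_majorityVote {Ψ : List Bool → ℕ → Option ℕ} (hΨ : IsFunctional Ψ)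
    (σ : List Bool) : Partrec (majorityVote Ψ σ) := by
  have hext : Primrec₂ fun (ρ : List Bool) (n : ℕ) => Ψ (σ ++ ρ) n :=
    hΨ.primrec.comp (Primrec.list_append.comp (Primrec.const σ) Primrec.fst) Primrec.snd
  have hconv : PrimrecRel fun (ρ : List Bool) (n : ℕ) => Ψ (σ ++ ρ) n ≠ none :=
    PrimrecPred.not (Primrec.eq.comp hext (Primrec.const none))
  have hone : PrimrecRel fun (ρ : List Bool) (n : ℕ) => Ψ (σ ++ ρ) n = some 1 :=
    Primrec.eq.comp hext (Primrec.const (some 1))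
  have h1 : PrimrecRel fun n m : ℕ => 3 * (strings m).length <
      4 * (strings m).countP fun ρ => decide (Ψ (σ ++ ρ) n ≠ none) :=
    Primrec.nat_lt.comp
      (Primrec.nat_mul.comp (Primrec.const 3) (primrec_length_strings.comp Primrec.snd))
      (Primrec.nat_mul.comp (Primrec.const 4) (primrec_countP_strings hconv))
  have h2 : PrimrecRel fun n m : ℕ => (strings m).length <
      2 * (strings m).countP fun ρ => decide (Ψ (σ ++ ρ) n = some 1) :=
    Primrec.nat_lt.comp (primrec_length_strings.comp Primrec.snd)
      (Primrec.nat_mul.comp (Primrec.const 2) (primrec_countP_strings hone))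
  exact (Partrec.rfind (Computable.partrec (Primrec.to_comp (PrimrecPred.decide h1))).to₂).map
    (Primrec.to_comp (PrimrecPred.decide h2))

/-- Cleared of denominators, so that inequalities between measures relative to `[σ]` become
inequalities between a count and `2 ^ m`. -/
theorem cantorMeasure_real_cyl_inter_mul_two_pow (σ : List Bool) (m : ℕ) (p : List Bool → Bool) :
    cantorMeasure.real (cyl σ ∩ {X | p (initSeg X (σ.length + m))}) * 2 ^ m =
      ((strings m).countP fun ρ => p (σ ++ ρ)) * cantorMeasure.real (cyl σ) := by
  rw [cantorMeasure_real_cyl_inter, cantorMeasure_real_cyl, pow_add, mul_assoc, mul_assoc,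
    ← mul_pow]
  norm_num

theorem cantorMeasure_real_cyl_pos (σ : List Bool) : 0 < cantorMeasure.real (cyl σ) := by
  rw [cantorMeasure_real_cyl]
  positivity

/-- The parts of `[σ]` on which `Ψ` has converged after `m` further bits increase with `m` and cover
`P ∩ [σ]`. By continuity from below one of them already exceeds `3 / 4`. -/
theorem majorityVote_dom {Ψ : List Bool → ℕ → Option ℕ} (hΨ : IsFunctional Ψ) {σ : List Bool}
    {P : Set (ℕ → Bool)} (hσ : 3 * cantorMeasure (cyl σ) < 4 * cantorMeasure (P ∩ cyl σ))
    {n : ℕ} (htot : ∀ X ∈ P, ∃ k v, v ∈ Ψ (initSeg X k) n) : (majorityVote Ψ σ n).Dom := by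
  suffices h : ∃ m, 3 * (strings m).length <
      4 * (strings m).countP fun ρ => decide (Ψ (σ ++ ρ) n ≠ none) by
    obtain ⟨m, hm⟩ := h
    exact Nat.rfind_dom.2 ⟨m, by simpa using hm, fun _ => trivial⟩
  set D : ℕ → Set (ℕ → Bool) := fun m =>
    cyl σ ∩ {X | decide (Ψ (initSeg X (σ.length + m)) n ≠ none) = true} with hD
  have hmono : Monotone D := by
    rintro k l hkl X ⟨h1, h2⟩
    refine ⟨h1, ?_⟩
    simp only [Set.mem_ofPred_eq, decide_eq_true_eq, Option.ne_none_iff_exists'] at h2 ⊢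
    obtain ⟨v, hv⟩ := h2
    exact ⟨v, hΨ.mono_initSeg (by omega) hv⟩
  have hsub : P ∩ cyl σ ⊆ ⋃ m, D m := by
    rintro X ⟨h1, h2⟩
    obtain ⟨k, v, hv⟩ := htot X h1
    refine Set.mem_iUnion.2 ⟨k, h2, ?_⟩
    simp only [Set.mem_ofPred_eq, decide_eq_true_eq, Option.ne_none_iff_exists']
    exact ⟨v, hΨ.mono_initSeg (by omega) hv⟩
  have hlt : 3 * cantorMeasure (cyl σ) < ⨆ m, 4 * cantorMeasure (D m) := by
    rw [← ENNReal.mul_iSup, ← hmono.measure_iUnion]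
    exact hσ.trans_le (by gcongr)
  obtain ⟨m, hm⟩ := lt_iSup_iff.1 hlt
  refine ⟨m, ?_⟩
  have hreal := ENNReal.toReal_strict_mono (by finiteness) hm
  rw [ENNReal.toReal_mul, ENNReal.toReal_mul, ← Measure.real, ← Measure.real] at hreal
  norm_num at hreal
  have hcount := cantorMeasure_real_cyl_inter_mul_two_pow σ m fun τ => decide (Ψ τ n ≠ none)
  change cantorMeasure.real (D m) * 2 ^ m = _ at hcount
  have hpos := cantorMeasure_real_cyl_pos σ
  rw [length_strings]
  set c := (strings m).countP fun ρ => decide (Ψ (σ ++ ρ) n ≠ none)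
  have : (3 * 2 ^ m : ℝ) * cantorMeasure.real (cyl σ) < (4 * c) * cantorMeasure.real (cyl σ) := by
    rw [mul_assoc 4, ← hcount]
    have := mul_lt_mul_of_pos_right hreal (show (0 : ℝ) < 2 ^ m by positivity)
    linarith
  have := lt_of_mul_lt_mul_right this hpos.le
  exact_mod_cast this

/-- A clopen event avoiding `P` must fit into the less than `1 / 4` of `[σ]` outside `P`. Additivity
needs only the event, not `P`, to be measurable. -/
theorem countP_lt_of_disjoint {σ : List Bool} {P : Set (ℕ → Bool)}
    (hσ : 3 * cantorMeasure (cyl σ) < 4 * cantorMeasure (P ∩ cyl σ)) (m : ℕ)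
    (p : List Bool → Bool) (hp : ∀ X ∈ P, ¬ p (initSeg X (σ.length + m))) :
    4 * ((strings m).countP fun ρ => p (σ ++ ρ)) < 2 ^ m := by
  set W := cyl σ ∩ {X | p (initSeg X (σ.length + m))} with hW
  have hWm : MeasurableSet W :=
    (measurableSet_cyl σ).inter (measurableSet_setOf_initSeg _ fun τ => p τ)
  have hdisj : Disjoint W (P ∩ cyl σ) := by
    rw [Set.disjoint_left]
    rintro X ⟨-, h1⟩ ⟨h2, -⟩
    exact hp X h2 h1
  have hle : cantorMeasure.real W + cantorMeasure.real (P ∩ cyl σ) ≤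
      cantorMeasure.real (cyl σ) := by
    rw [← measureReal_union' hdisj hWm]
    exact measureReal_mono (Set.union_subset Set.inter_subset_left Set.inter_subset_right)
  have hreal := ENNReal.toReal_strict_mono (by finiteness) hσ
  rw [ENNReal.toReal_mul, ENNReal.toReal_mul, ← Measure.real, ← Measure.real] at hreal
  norm_num at hreal
  have hcount := cantorMeasure_real_cyl_inter_mul_two_pow σ m p
  have hpos := cantorMeasure_real_cyl_pos σ
  set c := (strings m).countP fun ρ => p (σ ++ ρ)
  have hW4 : 4 * cantorMeasure.real W < cantorMeasure.real (cyl σ) := by linarith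
  have : (4 * c : ℝ) * cantorMeasure.real (cyl σ) < 2 ^ m * cantorMeasure.real (cyl σ) := by
    rw [mul_assoc, ← hcount, ← hW]
    have := mul_lt_mul_of_pos_right hW4 (show (0 : ℝ) < 2 ^ m by positivity)
    linarith
  exact_mod_cast lt_of_mul_lt_mul_right this hpos.le

/-- More than `3 / 4` of the strings have an answer and fewer than `1 / 4` have a wrong one. If `b`
is true, more than half answer `1`; if `b` is false, every answer `1` is wrong, so fewer than `1 /
4` give it. -/
theorem true_mem_majorityVote_iff {Ψ : List Bool → ℕ → Option ℕ} {σ : List Bool}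
    {P : Set (ℕ → Bool)} (hσ : 3 * cantorMeasure (cyl σ) < 4 * cantorMeasure (P ∩ cyl σ))
    {n : ℕ} (hdom : (majorityVote Ψ σ n).Dom) {b : Bool}
    (hagree : ∀ X ∈ P, ∀ k v, v ∈ Ψ (initSeg X k) n → v = b.toNat) :
    true ∈ majorityVote Ψ σ n ↔ b = true := by
  obtain ⟨c, hc⟩ := Part.dom_iff_mem.1 hdom
  suffices h : c = b by
    subst h
    exact ⟨fun h => Part.mem_unique hc h, fun h => h ▸ hc⟩
  obtain ⟨m, hm, rfl⟩ := (Part.mem_map_iff _).1 hc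
  have hconv := Nat.rfind_spec hm
  rw [Part.mem_some_iff, eq_comm, decide_eq_true_eq] at hconv
  have hwrong := countP_lt_of_disjoint hσ m
    (fun τ => decide (Ψ τ n ≠ none ∧ Ψ τ n ≠ some b.toNat)) (by
      intro X hX h
      rw [decide_eq_true_eq] at h
      obtain ⟨v, hv⟩ := Option.ne_none_iff_exists'.1 h.1
      exact h.2 (by rw [hv, hagree X hX _ v hv]))
  rw [length_strings] at hconv ⊢
  cases b with
  | true =>
    have := countP_le_add (p := fun ρ => decide (Ψ (σ ++ ρ) n ≠ none))
      (q := fun ρ => decide (Ψ (σ ++ ρ) n = some 1))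
      (s := fun ρ => decide (Ψ (σ ++ ρ) n ≠ none ∧ Ψ (σ ++ ρ) n ≠ some true.toNat))
      (fun ρ h => by
        simp only [decide_eq_true_eq, Bool.toNat_true] at h ⊢
        tauto) (strings m)
    rw [decide_eq_true_eq]
    omega
  | false =>
    have : ((strings m).countP fun ρ => decide (Ψ (σ ++ ρ) n = some 1)) ≤
        (strings m).countP fun ρ =>
          decide (Ψ (σ ++ ρ) n ≠ none ∧ Ψ (σ ++ ρ) n ≠ some false.toNat) :=
      List.countP_mono_left fun ρ _ h => by
        rw [decide_eq_true_eq] at h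
        simp [h]
    rw [decide_eq_false_iff_not]
    omega

/-- The step common to both reducibilities. Off the domain of `φ` the vote may err, but it is still
defined, and this is all that a computable `C` requires there. -/
theorem coarselyComputable_of_measure_ne_zero {Ψ : List Bool → ℕ → Option ℕ}
    (hΨ : IsFunctional Ψ) {B : Set ℕ} {r : ℝ} {φ : ℕ →. Bool}
    (hφ : ∀ n, ∀ b ∈ φ n, b = charSeq B n) (hr : r ≤ lowerDensity φ.Dom)
    {P : Set (ℕ → Bool)} (hP : cantorMeasure P ≠ 0)
    (htot : ∀ X ∈ P, ∀ n, ∃ k v, v ∈ Ψ (initSeg X k) n)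
    (hagree : ∀ X ∈ P, ∀ n, ∀ b ∈ φ n, ∀ k v, v ∈ Ψ (initSeg X k) n → v = b.toNat) :
    CoarselyComputableAtDensity B r := by
  obtain ⟨σ, hσ⟩ := exists_cyl_density hP
  have hdom : ∀ n, (majorityVote Ψ σ n).Dom := fun n =>
    majorityVote_dom hΨ hσ fun X hX => htot X hX n
  refine ⟨{n | true ∈ majorityVote Ψ σ n},
    computablePred_of_total (partrec_majorityVote hΨ σ) hdom,
    hr.trans (lowerDensity_mono fun n hn => ?_)⟩
  obtain ⟨b, hb⟩ := Part.dom_iff_mem.1 hn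
  have h := true_mem_majorityVote_iff hσ (hdom n) fun X hX k v => hagree X hX n b hb k v
  refine Iff.trans ?_ h.symm
  rw [hφ n b hb]
  simp [charSeq]

/-! ### Effective classes with primitive recursive matrix -/

/-- A class given by a primitive recursive clopen matrix `∀ j ∃ k` is `Π⁰_2`. -/
theorem isPiClass_two_of_primrec {g : List Bool → ℕ → Bool} (hg : Primrec₂ g) :
    IsPiClass 2 {X | ∀ j, ∃ k, g (initSeg X k) j} := by
  -- Here `p` codes `⟨⟨i, j⟩, k⟩` with `i` a dummy index. The strings kept are those where the
  -- matrix fails, since each level of `UniformlySigma` takes unions of complements.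
  have hF : Primrec fun p : ℕ =>
      (strings p.unpair.2).filter fun τ => decide (g τ p.unpair.1.unpair.2 = false) := by
    have hR : PrimrecRel fun (τ : List Bool) (j : ℕ) => g τ j = false :=
      Primrec.eq.comp hg (Primrec.const false)
    exact hR.listFilter.comp (primrec_strings.comp (Primrec.snd.comp Primrec.unpair))
      (Primrec.snd.comp (Primrec.unpair.comp (Primrec.fst.comp Primrec.unpair)))
  refine ⟨fun _ => {X | ∀ j, ∃ k, g (initSeg X k) j}ᶜ,
    ⟨fun i => {X | ∃ k, g (initSeg X k) i.unpair.2}, ⟨_, ⟨_, hF.to_comp, fun _ => rfl⟩, ?_⟩, ?_⟩,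
    rfl⟩
  · intro i
    ext X
    simp only [Set.mem_compl_iff, Set.mem_ofPred_eq, Set.mem_iUnion, Nat.unpair_pair,
      List.mem_filter, mem_strings, mem_cyl, decide_eq_true_eq, exists_prop]
    refine exists_congr fun k => ⟨?_, fun h => ?_⟩
    · rintro h ⟨τ, ⟨h1, h2⟩, h3⟩
      rw [← h3, h1, h] at h2
      cases h2
    · by_contra hg0
      exact h ⟨_, ⟨length_initSeg X k, by simpa using hg0⟩, by rw [length_initSeg]⟩
  · intro i
    ext X
    simp

/-- A class given by a primitive recursive clopen matrix `∀ i k` is `Π⁰_1`. -/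
theorem isPiClass_one_of_primrec {g : List Bool → ℕ → Bool} (hg : Primrec₂ g) :
    IsPiClass 1 {X | ∀ i k, g (initSeg X k) i} := by
  -- Here `p` codes a dummy index paired with `⟨i, k⟩`. With only one level of complements the
  -- strings kept are those where the matrix holds.
  have hF : Primrec fun p : ℕ =>
      (strings p.unpair.2.unpair.2).filter fun τ => decide (g τ p.unpair.2.unpair.1 = true) := by
    have hR : PrimrecRel fun (τ : List Bool) (j : ℕ) => g τ j = true :=
      Primrec.eq.comp hg (Primrec.const true)
    have h : Primrec fun p : ℕ => p.unpair.2.unpair :=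
      Primrec.unpair.comp (Primrec.snd.comp Primrec.unpair)
    exact hR.listFilter.comp (primrec_strings.comp (Primrec.snd.comp h)) (Primrec.fst.comp h)
  refine ⟨fun _ => {X | ∀ i k, g (initSeg X k) i}ᶜ,
    ⟨_, ⟨_, hF.to_comp, fun _ => rfl⟩, ?_⟩, rfl⟩
  intro i
  ext X
  simp only [Set.mem_compl_iff, Set.mem_ofPred_eq, Set.mem_iUnion, Nat.unpair_pair,
    List.mem_filter, mem_strings, mem_cyl, decide_eq_true_eq, exists_prop]
  rw [← not_forall, not_iff_not]
  constructor
  · intro h j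
    exact ⟨_, ⟨length_initSeg X j.unpair.2, h _ _⟩, by rw [length_initSeg]⟩
  · intro h i k
    obtain ⟨τ, ⟨h1, h2⟩, h3⟩ := h (Nat.pair i k)
    simp only [Nat.unpair_pair] at h1 h2
    rw [← h1, h3]
    exact h2

/-! ### Stage approximations and truth-table functionals -/

/-- A partial computable function has a primitive recursive approximation by stages. -/
theorem exists_primrec_stages {α β : Type*} [Primcodable α] [Primcodable β] {φ : α →. β}
    (hφ : Partrec φ) :
    ∃ a : ℕ → α → Option β, Primrec₂ a ∧ (∀ {s t n b}, s ≤ t → b ∈ a s n → b ∈ a t n) ∧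
      ∀ n b, b ∈ φ n ↔ ∃ s, b ∈ a s n := by
  obtain ⟨c, hc⟩ := Nat.Partrec.Code.exists_code.1 hφ
  refine ⟨fun s n => (Nat.Partrec.Code.evaln s c (Encodable.encode n)).bind Encodable.decode,
    ?_, ?_, ?_⟩
  · refine Primrec.option_bind ?_ (Primrec.decode.comp Primrec.snd)
    exact Nat.Partrec.Code.primrec_evaln.comp
      (Primrec.pair (Primrec.pair Primrec.fst (Primrec.const c)) (Primrec.encode.comp Primrec.snd))
  · intro s t n b hst h
    simp only [Option.mem_def, Option.bind_eq_some_iff] at h ⊢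
    obtain ⟨v, hv, hb⟩ := h
    exact ⟨v, Nat.Partrec.Code.evaln_mono hst hv, hb⟩
  · intro n b
    have heval : ∀ v, v ∈ c.eval (Encodable.encode n) ↔ ∃ b ∈ φ n, Encodable.encode b = v := by
      intro v
      rw [hc]
      simp
    simp only [Option.mem_def, Option.bind_eq_some_iff]
    constructor
    · intro hb
      obtain ⟨s, hs⟩ := Nat.Partrec.Code.evaln_complete.1 ((heval _).2 ⟨b, hb, rfl⟩)
      exact ⟨s, _, hs, Encodable.encodek b⟩
    · rintro ⟨s, v, hv, hb⟩
      obtain ⟨b', hb', rfl⟩ := (heval _).1 (Nat.Partrec.Code.evaln_sound hv)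
      rw [Encodable.encodek, Option.some.injEq] at hb
      exact hb ▸ hb'

/-- The functional of the truth-table reduction approximated by `a`. -/
def ttFunctional (a : ℕ → ℕ → Option TruthTable) (σ : List Bool) (n : ℕ) : Option ℕ :=
  (a σ.length n).bind fun t =>
    -- Waiting for every query to be answered means that the default `false` below never matters and
    -- that outputs persist.
    if ∀ q ∈ t.1, q < σ.length then
      some (if t.1.map (fun q => σ.getD q false) ∈ t.2 then 1 else 0)
    else none

theorem getD_of_prefix {σ τ : List Bool} (h : σ <+: τ) {q : ℕ} (hq : q < σ.length) :
    τ.getD q false = σ.getD q false := by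
  obtain ⟨ρ, rfl⟩ := h
  exact List.getD_append _ _ _ _ hq

theorem mem_ttFunctional {a : ℕ → ℕ → Option TruthTable} {σ : List Bool} {n v : ℕ} :
    v ∈ ttFunctional a σ n ↔ ∃ t ∈ a σ.length n, (∀ q ∈ t.1, q < σ.length) ∧
      v = if t.1.map (fun q => σ.getD q false) ∈ t.2 then 1 else 0 := by
  simp only [ttFunctional, Option.mem_def, Option.bind_eq_some_iff]
  refine exists_congr fun t => and_congr_right fun _ => ?_
  rw [Option.ite_none_right_eq_some, Option.some.injEq, eq_comm (a := v)]

theorem isFunctional_tt {a : ℕ → ℕ → Option TruthTable} (ha : Primrec₂ a)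
    (hmono : ∀ {s t n b}, s ≤ t → b ∈ a s n → b ∈ a t n) : IsFunctional (ttFunctional a) where
  primrec := by
    refine Primrec.option_bind
      (ha.comp (Primrec.list_length.comp Primrec.fst) Primrec.snd) ?_
    have hq : Primrec fun p : (List Bool × ℕ) × TruthTable => p.2.1 :=
      Primrec.fst.comp Primrec.snd
    have hσ : Primrec fun p : (List Bool × ℕ) × TruthTable => p.1.1 :=
      Primrec.fst.comp Primrec.fst
    have h1 : PrimrecPred fun p : (List Bool × ℕ) × TruthTable => ∀ q ∈ p.2.1, q < p.1.1.length :=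
      (PrimrecRel.forall_mem_list Primrec.nat_lt).comp hq (Primrec.list_length.comp hσ)
    have h2 : Primrec fun p : (List Bool × ℕ) × TruthTable =>
        p.2.1.map fun q => p.1.1.getD q false :=
      Primrec.list_map hq ((Primrec.list_getD false).comp (hσ.comp Primrec.fst) Primrec.snd)
    have h3 : PrimrecPred fun p : (List Bool × ℕ) × TruthTable =>
        (p.2.1.map fun q => p.1.1.getD q false) ∈ p.2.2 := by
      refine ((PrimrecRel.exists_mem_list Primrec.eq).comp (Primrec.snd.comp Primrec.snd) h2).of_eq
        fun p => ?_
      simp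
    exact Primrec.ite h1
      (Primrec.option_some.comp (Primrec.ite h3 (Primrec.const 1) (Primrec.const 0)))
      (Primrec.const none)
  mono := by
    intro σ τ n v h hv
    rw [mem_ttFunctional] at hv ⊢
    obtain ⟨t, ht, hq, rfl⟩ := hv
    refine ⟨t, hmono h.length_le ht, fun q hq' => (hq q hq').trans_le h.length_le, ?_⟩
    rw [List.map_congr_left fun q hq' => getD_of_prefix h (hq q hq')]

theorem getD_initSeg (X : ℕ → Bool) {k q : ℕ} (hq : q < k) : (initSeg X k).getD q false = X q := by
  rw [List.getD_eq_getElem _ _ (by simpa using hq)]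
  simp [initSeg]

/-- Convergence on every oracle, not just on `A`: this saves a quantifier over the Turing case. -/
theorem exists_mem_ttFunctional {a : ℕ → ℕ → Option TruthTable}
    (hmono : ∀ {s t n b}, s ≤ t → b ∈ a s n → b ∈ a t n) {f : ℕ → TruthTable} {n : ℕ}
    (hf : ∃ s, f n ∈ a s n) (X : ℕ → Bool) : ∃ k v, v ∈ ttFunctional a (initSeg X k) n := by
  obtain ⟨s, hs⟩ := hf
  -- The sum of the queries bounds each of them, and `+ 1` makes the bound strict.
  refine ⟨s + ((f n).1.sum + 1), _, mem_ttFunctional.2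
    ⟨f n, hmono (by simp) hs, fun q hq => ?_, rfl⟩⟩
  have := List.le_sum_of_mem hq
  simp only [length_initSeg]
  omega

theorem eq_of_mem_ttFunctional {a : ℕ → ℕ → Option TruthTable} {f : ℕ → TruthTable}
    (hf : ∀ n t, t = f n ↔ ∃ s, t ∈ a s n) {A B : Set ℕ}
    (hB : ∀ n, n ∈ B ↔ TruthTable.Sat (f n) A) {k n v : ℕ}
    (hv : v ∈ ttFunctional a (initSeg (charSeq A) k) n) : v = (charSeq B n).toNat := by
  obtain ⟨t, ht, hq, rfl⟩ := mem_ttFunctional.1 hv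
  obtain rfl := (hf n t).2 ⟨_, ht⟩
  rw [List.map_congr_left fun q hq' => getD_initSeg (charSeq A) (by simpa using hq q hq')]
  by_cases h : n ∈ B
  · rw [if_pos (show (f n).1.map (charSeq A) ∈ (f n).2 from (hB n).1 h)]
    simp [charSeq, h]
  · rw [if_neg fun h' : (f n).1.map (charSeq A) ∈ (f n).2 => h ((hB n).2 h')]
    simp [charSeq, h]

/-! ### The two reducibilities -/

theorem coarselyComputable_of_tt {A B : Set ℕ} {r : ℝ} (hA : WeaklyRandom 1 A)
    (hBA : SetTTReducible B A) (hB : PartiallyComputableAtDensity B r) :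
    CoarselyComputableAtDensity B r := by
  obtain ⟨f, hf, hfB⟩ := hBA
  obtain ⟨φ, hφ, hφB, hr⟩ := hB
  obtain ⟨a, ha, hamono, hafn⟩ := exists_primrec_stages (Computable.partrec hf)
  simp only [PFun.coe_val, Part.mem_some_iff] at hafn
  obtain ⟨d, hd, -, hdφ⟩ := exists_primrec_stages hφ
  have hΨ := isFunctional_tt ha hamono
  -- The index `i` codes an argument and a stage of `φ`. Missing values count as consistent, so only
  -- a visible contradiction with `φ` expels an oracle.
  let g : List Bool → ℕ → Bool := fun σ i =>
    decide (d i.unpair.2 i.unpair.1 = none ∨ ttFunctional a σ i.unpair.1 = none ∨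
      ttFunctional a σ i.unpair.1 = (d i.unpair.2 i.unpair.1).map Bool.toNat)
  have hg : Primrec₂ g := by
    have hd' : Primrec fun p : List Bool × ℕ => d p.2.unpair.2 p.2.unpair.1 :=
      hd.comp (Primrec.snd.comp (Primrec.unpair.comp Primrec.snd))
        (Primrec.fst.comp (Primrec.unpair.comp Primrec.snd))
    have hΨ' : Primrec fun p : List Bool × ℕ => ttFunctional a p.1 p.2.unpair.1 :=
      hΨ.primrec.comp Primrec.fst (Primrec.fst.comp (Primrec.unpair.comp Primrec.snd))
    exact PrimrecPred.decide ((Primrec.eq.comp hd' (Primrec.const none)).or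
      ((Primrec.eq.comp hΨ' (Primrec.const none)).or
        (Primrec.eq.comp hΨ' (Primrec.option_map hd'
          ((Primrec.dom_finite Bool.toNat).comp Primrec.snd)))))
  refine coarselyComputable_of_measure_ne_zero hΨ hφB hr
    (P := {X | ∀ i k, g (initSeg X k) i}) ?_ ?_ ?_
  · refine fun h0 => hA _ (isPiClass_one_of_primrec hg) h0 fun i k => ?_
    simp only [g, decide_eq_true_eq]
    by_contra! hcon
    obtain ⟨h1, h2, h3⟩ := hcon
    obtain ⟨b, hb⟩ := Option.ne_none_iff_exists'.1 h1
    obtain ⟨v, hv⟩ := Option.ne_none_iff_exists'.1 h2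
    rw [hb, hv, eq_of_mem_ttFunctional hafn hfB hv, hφB _ b ((hdφ _ _).2 ⟨_, hb⟩)] at h3
    exact h3 rfl
  · exact fun X _ n => exists_mem_ttFunctional hamono ((hafn n _).1 rfl) X
  · intro X hX n b hb k v hv
    obtain ⟨s, hs⟩ := (hdφ n b).1 hb
    have := hX (Nat.pair n s) k
    simp only [g, decide_eq_true_eq, Nat.unpair_pair, Option.mem_def.1 hs,
      Option.mem_def.1 hv] at this
    simpa using this

theorem coarselyComputable_of_turing {A B : Set ℕ} {r : ℝ} (hA : WeaklyRandom 2 A)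
    (hBA : SetTuringReducible B A) (hB : PartiallyComputableAtDensity B r) :
    CoarselyComputableAtDensity B r := by
  obtain ⟨φ, hφ, hφB, hr⟩ := hB
  obtain ⟨Ψ, hΨ, hΨB⟩ := exists_functional_of_recursiveIn (RecursiveIn.iff_nat.1 hBA)
  have hmem : ∀ n v, v = (charSeq B n).toNat ↔ ∃ k, v ∈ Ψ (initSeg (charSeq A) k) n := by
    intro n v
    rw [← hΨB n v, charFun, Part.mem_some_iff]
  obtain ⟨d, hd, -, hdφ⟩ := exists_primrec_stages hφ
  -- Unlike the truth-table case, a missing value of `Ψ` counts as failure, so `∃ k` enforces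
  -- totality along with agreement.
  let g : List Bool → ℕ → Bool := fun σ i =>
    decide (Ψ σ i.unpair.1 ≠ none ∧ (d i.unpair.2 i.unpair.1 = none ∨
      Ψ σ i.unpair.1 = (d i.unpair.2 i.unpair.1).map Bool.toNat))
  have hg : Primrec₂ g := by
    have hd' : Primrec fun p : List Bool × ℕ => d p.2.unpair.2 p.2.unpair.1 :=
      hd.comp (Primrec.snd.comp (Primrec.unpair.comp Primrec.snd))
        (Primrec.fst.comp (Primrec.unpair.comp Primrec.snd))
    have hΨ' : Primrec fun p : List Bool × ℕ => Ψ p.1 p.2.unpair.1 :=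
      hΨ.primrec.comp Primrec.fst (Primrec.fst.comp (Primrec.unpair.comp Primrec.snd))
    exact PrimrecPred.decide ((Primrec.eq.comp hΨ' (Primrec.const none)).not.and
      ((Primrec.eq.comp hd' (Primrec.const none)).or
        (Primrec.eq.comp hΨ' (Primrec.option_map hd'
          ((Primrec.dom_finite Bool.toNat).comp Primrec.snd)))))
  refine coarselyComputable_of_measure_ne_zero hΨ hφB hr
    (P := {X | ∀ i, ∃ k, g (initSeg X k) i}) ?_ ?_ ?_
  · refine fun h0 => hA _ (isPiClass_two_of_primrec hg) h0 fun i => ?_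
    obtain ⟨k, hk⟩ := (hmem i.unpair.1 _).1 rfl
    refine ⟨k, ?_⟩
    simp only [g, decide_eq_true_eq, Option.mem_def.1 hk]
    refine ⟨by simp, ?_⟩
    by_contra! hcon
    obtain ⟨h1, h2⟩ := hcon
    obtain ⟨b, hb⟩ := Option.ne_none_iff_exists'.1 h1
    rw [hb, hφB _ b ((hdφ _ _).2 ⟨_, hb⟩)] at h2
    exact h2 rfl
  · intro X hX n
    -- Any stage would do, as only convergence is used.
    obtain ⟨k, hk⟩ := hX (Nat.pair n 0)
    simp only [g, decide_eq_true_eq, Nat.unpair_pair] at hk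
    exact ⟨k, Option.ne_none_iff_exists'.1 hk.1⟩
  · intro X hX n b hb k v hv
    obtain ⟨s, hs⟩ := (hdφ n b).1 hb
    obtain ⟨l, hl⟩ := hX (Nat.pair n s)
    simp only [g, decide_eq_true_eq, Nat.unpair_pair, Option.mem_def.1 hs] at hl
    exact hΨ.unique hv (by simpa using hl.2)

end CoarseComputability

theorem theorem5p3 (A B : Set ℕ) (r : ℝ) (hr : r ∈ Set.Icc (0 : ℝ) 1) :
    (CoarseComputability.WeaklyRandom 1 A →
      CoarseComputability.SetTTReducible B A →
      CoarseComputability.PartiallyComputableAtDensity B r →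
      CoarseComputability.CoarselyComputableAtDensity B r) ∧
    (CoarseComputability.WeaklyRandom 2 A →
      CoarseComputability.SetTuringReducible B A →
      CoarseComputability.PartiallyComputableAtDensity B r →
      CoarseComputability.CoarselyComputableAtDensity B r) :=
  ⟨CoarseComputability.coarselyComputable_of_tt, CoarseComputability.coarselyComputable_of_turing⟩
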